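/- **Setting.** An instance $I$ of $1\,|\,r_j,\text{online},p_j=1,\text{restart}\,|\,WC_{\max}$ consists of $n\ge 1$ jobs with unit processing time, release dates $r_j\ge 0$ and weights $w_j>0$; the job $j$ becomes known at time $r_j$. A single machine processes at most one job at a time, and a job $j$ only from time $r_j$ on. A running job may be interrupted; then all work on it is lost and it must later be run again from the start. A job completes once it has run for one time unit without interruption. If $C_j$ is the completion time of job $j$, the objective is to minimize $WC_{\max}=\max_j w_jC_j$; $\mathrm{OPT}(I)$ denotes the smallest value of $WC_{\max}$ over all feasible schedules with restarts. **Algorithm LLW (Limited Largest Weight).** Let $R$ be the positive real root of $3R^3-2R^2-R-2=0$. Whenever the machine is free and some released job is not completed, LLW immediately starts a heaviest such job (ties are resolved in any way); if there is no such job, it idles until the next arrival. If a job is started at a time $t\ge\frac{2-R}{R-1}$, it is never interrupted. If a job is started at a time $t<\frac{2-R}{R-1}$, it is interrupted at the first time in the open interval $(t,t')$ at which a strictly heavier job arrives, where $t'=\frac{t+2}{R}-1$, and the machine is then free; if no such job arrives during $(t,t')$, the running job is continued until it completes. **Theorem.** The equation $3R^3-2R^2-R-2=0$ has exactly one positive real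 root $R$, and $1.3097<R<1.3098$. On every instance, LLW terminates with a feasible schedule in which all jobs are completed. LLW is $R$-competitive, i.e. $\mathrm{LLW}(I)\le R\cdot\mathrm{OPT}(I)$ for every instance $I$, and this bound is tight: $\sup_I \mathrm{LLW}(I)/\mathrm{OPT}(I)=R$. More precisely, for every $c<R$ there is an instance $I$ on which, however ties are resolved, $\mathrm{LLW}(I)/\mathrm{OPT}(I)>c$. -/

import Mathlib

namespace Sched

/-- A nonempty instance of the problem of scheduling unit jobs on a single machine: job `j` has
release date `release j ≥ 0` and weight `weight j > 0`; all processing times are `1`. -/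
structure JobInstance where
  n : ℕ
  n_pos : 0 < n
  release : Fin n → ℝ
  weight : Fin n → ℝ
  release_nonneg : ∀ j, 0 ≤ release j
  weight_pos : ∀ j, 0 < weight j

/-- A run: the machine processes `job` without a break from time `start` to time `finish`.
A run of length `1` completes its job; after a shorter run all its work is lost. -/
structure Run (n : ℕ) where
  job : Fin n
  start : ℝ
  finish : ℝ

/-- The run completes its job. -/
def Run.Completes {n : ℕ} (x : Run n) : Prop := x.finish = x.start + 1

/-- Job `j` is completed by one of the runs of the list. -/
def Completed {n : ℕ} (L : List (Run n)) (j : Fin n) : Prop :=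
  ∃ x ∈ L, x.job = j ∧ x.Completes

/-- Feasible schedules with restarts, as chronological lists of runs: no job runs before its
release date or for more than one time unit at a stretch, the machine processes at most one job
at a time, a completed job is not run again, and every job is completed. -/
structure IsSchedule (I : JobInstance) (L : List (Run I.n)) : Prop where
  release_le : ∀ x ∈ L, I.release x.job ≤ x.start
  start_lt : ∀ x ∈ L, x.start < x.finish
  finish_le : ∀ x ∈ L, x.finish ≤ x.start + 1
  ordered : L.Pairwise fun x y => x.finish ≤ y.start
  not_again : L.Pairwise fun x y => x.Completes → y.job ≠ x.job
  all_completed : ∀ j, Completed L j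

/-- The completion time of job `j`, i.e. the end of its (unique, in a feasible schedule)
completing run. -/
noncomputable def completionTime {n : ℕ} (L : List (Run n)) (j : Fin n) : ℝ :=
  sInf {c | ∃ x ∈ L, x.job = j ∧ x.Completes ∧ x.finish = c}

/-- The weighted makespan: the maximum over all jobs of weight times completion time. -/
noncomputable def weightedMakespan (I : JobInstance) (L : List (Run I.n)) : ℝ :=
  ⨆ j : Fin I.n, I.weight j * completionTime L j

/-- The offline optimum: the least weighted makespan of a feasible schedule with restarts. -/
noncomputable def opt (I : JobInstance) : ℝ :=
  sInf {c | ∃ L, IsSchedule I L ∧ weightedMakespan I L = c}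

/-! ### The algorithm Limited Largest Weight, with parameter `R` -/

/-- The algorithm never interrupts jobs that it starts at this time or later. -/
noncomputable def noInterruptTime (R : ℝ) : ℝ := (2 - R) / (R - 1)

/-- A job started at time `t < noInterruptTime R` can be interrupted before this time only. -/
noncomputable def phaseEnd (R t : ℝ) : ℝ := (t + 2) / R - 1

/-- A state of the algorithm at a moment when the machine is free: the current time, and the runs
made so far in chronological order. -/
structure State (n : ℕ) where
  time : ℝ
  runs : List (Run n)

/-- Job `j` has been released and is not yet completed. -/
def Waiting (I : JobInstance) (s : State I.n) (j : Fin I.n) : Prop :=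
  I.release j ≤ s.time ∧ ¬ Completed s.runs j

/-- Job `j` is a heaviest waiting job (several waiting jobs may have the same weight). -/
def HeaviestWaiting (I : JobInstance) (s : State I.n) (j : Fin I.n) : Prop :=
  Waiting I s j ∧ ∀ i, Waiting I s i → I.weight i ≤ I.weight j

/-- Job `i` is heavier than job `j` and arrives during the phase in which job `j`, if it is
started at time `t`, can be interrupted. -/
def Challenges (R : ℝ) (I : JobInstance) (t : ℝ) (j i : Fin I.n) : Prop :=
  t < noInterruptTime R ∧ I.weight j < I.weight i ∧ t < I.release i ∧ I.release i < phaseEnd R t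

/-- One step of the algorithm. If no job is waiting, it idles until the next arrival. Otherwise it
starts a heaviest waiting job at once (ties may be resolved in any way); this job is interrupted at
the first arrival of a job that challenges it, and it runs to completion if there is none. -/
inductive Step (R : ℝ) (I : JobInstance) : State I.n → State I.n → Prop
  | idle (s : State I.n) (i : Fin I.n)
      (none_waiting : ∀ j, ¬ Waiting I s j)
      (not_completed : ¬ Completed s.runs i)
      (next : ∀ j, ¬ Completed s.runs j → I.release i ≤ I.release j) :
      Step R I s ⟨I.release i, s.runs⟩
  | complete (s : State I.n) (j : Fin I.n)
      (heaviest : HeaviestWaiting I s j)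
      (unchallenged : ∀ i, ¬ Challenges R I s.time j i) :
      Step R I s ⟨s.time + 1, s.runs ++ [⟨j, s.time, s.time + 1⟩]⟩
  | interrupt (s : State I.n) (j i : Fin I.n)
      (heaviest : HeaviestWaiting I s j)
      (challenged : Challenges R I s.time j i)
      (first : ∀ i', Challenges R I s.time j i' → I.release i ≤ I.release i') :
      Step R I s ⟨I.release i, s.runs ++ [⟨j, s.time, I.release i⟩]⟩

/-- `L` is the list of runs of an execution of the algorithm on `I` that starts at time `0` and
has come to its end. -/
def IsLLWSchedule (R : ℝ) (I : JobInstance) (L : List (Run I.n)) : Prop :=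
  ∃ t : ℝ, Relation.ReflTransGen (Step R I) ⟨0, []⟩ ⟨t, L⟩ ∧ ∀ s, ¬ Step R I ⟨t, L⟩ s

/-- The algorithm is `c`-competitive. -/
def LLWCompetitive (R c : ℝ) : Prop :=
  ∀ (I : JobInstance) (L : List (Run I.n)), IsLLWSchedule R I L → weightedMakespan I L ≤ c * opt I

/-- The ratios of the algorithm's value to the optimum; their supremum is its competitive ratio. -/
def llwRatios (R : ℝ) : Set ℝ :=
  {x | ∃ (I : JobInstance) (L : List (Run I.n)),
    IsLLWSchedule R I L ∧ x = weightedMakespan I L / opt I}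

end Sched

/-!
Write `f = phaseEnd R`. A job started at time `t < noInterruptTime R` can be interrupted before
time `f t` only.

**Upper bound.** Fix a weight `w` and consider the maximal periods ("blocks") in which the algorithm
runs jobs of weight at least `w` only. If `S` is a set of such jobs, all released at time `ρ` or
later, then every schedule has cost at least `w * (ρ + |S|)` (`le_opt`). A job of weight `w` that
is completed in a block beginning at time `a` completes at most at
`a + |S| + (time wasted by interruptions)`, where `S` consists of the jobs of weight at least `w`
that were completed in the block or are waiting. There are two ways to lose against `ρ + |S|`.

* The block follows the completion of a lighter job started at time `u`. Then `a = u + 1`, and the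
  jobs of the block were released at time `f u` or later, since the lighter job was not interrupted
  (or later than `u`, if `u ≥ noInterruptTime R`). The function `f` and the number
  `noInterruptTime R` are such that the ratio is still at most `R`.
* Jobs are interrupted. If `(R - 1) * t ≥ 2 - R ^ 2`, an interruption of a job started at `t` wastes
  at most `R - 1` time units. This is what the newly arrived heavier job adds to `(R - 1) * |S|`.
  Earlier than that, no job can be completed since the block began, and if `m` interruptions
  have occurred, the time is at most `f^[m] ρ` while `m + 1` jobs are waiting; for `m ≤ 2` it
  suffices to compare these, and the case `m = 2`, `ρ = 0` is exactly `3 + f (f 0) = 3 * R`, the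
  equation that defines `R`. A third early interruption has enough slack.

`InBlock` is the resulting invariant of the steps of the algorithm, preserved by
`InBlock.complete` and `InBlock.interrupt`, and established anew by `InBlock.of_time_eq` and
`blockInvariant_of_complete_light` whenever a step concerns no job of weight at least `w`.

**Lower bound.** Three jobs of almost equal weights arrive at time `0` and just before the ends of
the phases `f 0` and `f (f 0)`. The algorithm interrupts the first two and completes the lightest
job last, at almost `f (f 0) + 3 = 3 * R`, while the optimum is almost `3` (`exists_lt_ratio`).

**Termination.** Each step completes a job or moves on to a later release date
(`wellFounded_step`).
-/

namespace Sched

/-! ### The constant `R` -/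

lemma existsUnique_root :
    ∃! R : ℝ, 0 < R ∧ 3 * R ^ 3 - 2 * R ^ 2 - R - 2 = 0 := by
  have hc : ContinuousOn (fun x : ℝ => 3 * x ^ 3 - 2 * x ^ 2 - x - 2) (Set.Icc 1 2) := by
    fun_prop
  obtain ⟨R, hR, hR0⟩ := intermediate_value_Icc (by norm_num) hc
    (show (0 : ℝ) ∈ Set.Icc _ _ by constructor <;> norm_num)
  have hR1 : 1 ≤ R := hR.1
  refine ⟨R, ⟨by linarith, hR0⟩, ?_⟩
  rintro S ⟨hS, hS0⟩
  simp only at hR0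
  have hfac : (S - R) * (3 * (S ^ 2 + S * R + R ^ 2) - 2 * (S + R) - 1) = 0 := by
    linear_combination hS0 - hR0
  rcases mul_eq_zero.1 hfac with h | h
  · linarith
  · -- the second factor is `3 S² + (3 R - 2) S + (3 R² - 2 R - 1)`, and the last bracket is `≥ 0`
    nlinarith [mul_pos hS hS, mul_nonneg hS.le (sub_nonneg.2 hR1),
      mul_nonneg (sub_nonneg.2 hR1) (sub_nonneg.2 hR1)]

lemma root_bounds {R : ℝ} (h0 : 0 < R) (hR : 3 * R ^ 3 - 2 * R ^ 2 - R - 2 = 0) :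
    1.3097 < R ∧ R < 1.3098 := by
  constructor
  · by_contra! h
    by_cases h1 : R ≤ 1
    · nlinarith [mul_pos h0 h0, mul_nonneg (mul_pos h0 h0).le (sub_nonneg.2 h1),
        mul_nonneg h0.le (sub_nonneg.2 h1)]
    · push Not at h1
      nlinarith [mul_nonneg (sub_nonneg.2 h) (mul_pos h0 h0).le,
        mul_nonneg (sub_nonneg.2 h) (sub_pos.2 h1).le, mul_pos (sub_pos.2 h1) (sub_pos.2 h1)]
  · by_contra! h
    nlinarith [mul_nonneg (sub_nonneg.2 h) (mul_pos h0 h0).le,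
        mul_nonneg (sub_nonneg.2 h) h0.le]

lemma mul_phaseEnd {R : ℝ} (hR : 0 < R) (t : ℝ) : R * phaseEnd R t = t + 2 - R := by
  unfold phaseEnd
  field_simp

lemma phaseEnd_lt_add_one {R t : ℝ} (hR : 1 < R) (ht : 0 ≤ t) : phaseEnd R t < t + 1 := by
  nlinarith [mul_phaseEnd (R := R) (by linarith) t]

/-! ### Steps of the algorithm -/

lemma completed_append_singleton {n : ℕ} {L : List (Run n)} {x : Run n} {j : Fin n} :
    Completed (L ++ [x]) j ↔ Completed L j ∨ (x.job = j ∧ x.Completes) := by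
  simp only [Completed, List.mem_append, List.mem_singleton]
  constructor
  · rintro ⟨y, hy | rfl, h⟩
    · exact Or.inl ⟨y, hy, h⟩
    · exact Or.inr h
  · rintro (⟨y, hy, h⟩ | h)
    · exact ⟨y, Or.inl hy, h⟩
    · exact ⟨x, Or.inr rfl, h⟩

lemma Step.completed_mono {R : ℝ} {I : JobInstance} {s s' : State I.n} (h : Step R I s s')
    {j : Fin I.n} (hj : Completed s.runs j) : Completed s'.runs j := by
  cases h with
  | idle => exact hj
  | complete => exact completed_append_singleton.2 (Or.inl hj)
  | interrupt => exact completed_append_singleton.2 (Or.inl hj)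

lemma lt_release_of_not_waiting {I : JobInstance} {s : State I.n} {j : Fin I.n}
    (hw : ¬ Waiting I s j) (hc : ¬ Completed s.runs j) : s.time < I.release j := by
  by_contra! h
  exact hw ⟨h, hc⟩

lemma Step.time_lt {R : ℝ} {I : JobInstance} {s s' : State I.n} (h : Step R I s s') :
    s.time < s'.time := by
  cases h with
  | idle i hn hc _ => exact lt_release_of_not_waiting (hn i) hc
  | complete => exact lt_add_one _
  | interrupt j i _ hc _ => exact hc.2.2.1

open Classical in
/-- Each step completes a job or moves the time up to or past a release date; hence the number of
uncompleted jobs plus the number of future arrivals decreases. -/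
lemma wellFounded_step (R : ℝ) (I : JobInstance) :
    WellFounded fun s' s => Step R I s s' := by
  let f : State I.n → ℕ := fun s =>
    (Finset.univ.filter fun j => ¬ Completed s.runs j).card +
      (Finset.univ.filter fun j => s.time < I.release j).card
  refine Subrelation.wf (r := InvImage (· < ·) f) ?_ (InvImage.wf f Nat.lt_wfRel.wf)
  intro s' s h
  change f s' < f s
  have h1 : (Finset.univ.filter fun j => ¬ Completed s'.runs j) ⊆
      Finset.univ.filter fun j => ¬ Completed s.runs j := by
    intro j
    simp only [Finset.mem_filter, Finset.mem_univ, true_and]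
    exact mt h.completed_mono
  have h2 : (Finset.univ.filter fun j => s'.time < I.release j) ⊆
      Finset.univ.filter fun j => s.time < I.release j := by
    intro j
    simp only [Finset.mem_filter, Finset.mem_univ, true_and]
    exact h.time_lt.trans
  have arrival : ∀ i, s'.time = I.release i → f s' < f s := by
    intro i hi
    refine Nat.add_lt_add_of_le_of_lt (Finset.card_le_card h1) (Finset.card_lt_card ?_)
    refine (Finset.ssubset_iff_of_subset h2).2 ⟨i, ?_, ?_⟩
    · simpa [hi] using h.time_lt
    · simp [hi]
  cases h with
  | idle i => exact arrival i rfl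
  | interrupt j i => exact arrival i rfl
  | complete j hj _ =>
    refine Nat.add_lt_add_of_lt_of_le (Finset.card_lt_card ?_) (Finset.card_le_card h2)
    refine (Finset.ssubset_iff_of_subset h1).2 ⟨j, ?_, ?_⟩
    · simpa using hj.1.2
    · simp [completed_append_singleton, Run.Completes]

open Classical in
lemma exists_step (R : ℝ) (I : JobInstance) (s : State I.n) (h : ∃ j, ¬ Completed s.runs j) :
    ∃ s', Step R I s s' := by
  by_cases hw : ∃ j, Waiting I s j
  · obtain ⟨j, hj, hmax⟩ := Finset.exists_max_image (Finset.univ.filter (Waiting I s)) I.weight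
      (by obtain ⟨j, hj⟩ := hw; exact ⟨j, by simpa using hj⟩)
    have hj' : HeaviestWaiting I s j :=
      ⟨by simpa using hj, fun i hi => hmax i (by simpa using hi)⟩
    by_cases hc : ∃ i, Challenges R I s.time j i
    · obtain ⟨i, hi, hmin⟩ := Finset.exists_min_image
        (Finset.univ.filter (Challenges R I s.time j)) I.release
        (by obtain ⟨j, hj⟩ := hc; exact ⟨j, by simpa using hj⟩)
      exact ⟨_, .interrupt s j i hj' (by simpa using hi) fun i' hi' => hmin i' (by simpa using hi')⟩
    · exact ⟨_, .complete s j hj' (not_exists.1 hc)⟩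
  · obtain ⟨i, hi, hmin⟩ := Finset.exists_min_image
      (Finset.univ.filter fun j => ¬ Completed s.runs j) I.release
      (by obtain ⟨j, hj⟩ := h; exact ⟨j, by simpa using hj⟩)
    exact ⟨_, .idle s i (not_exists.1 hw) (by simpa using hi)
      fun j hj => hmin j (by simpa using hj)⟩

lemma exists_isLLWSchedule (R : ℝ) (I : JobInstance) : ∃ L, IsLLWSchedule R I L := by
  have key : ∀ s : State I.n, ∃ s', Relation.ReflTransGen (Step R I) s s' ∧
      ∀ s'', ¬ Step R I s' s'' := by
    intro s
    induction s using (wellFounded_step R I).induction with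
    | _ s ih =>
      by_cases h : ∃ s', Step R I s s'
      · obtain ⟨s', hs'⟩ := h
        obtain ⟨e, he, hend⟩ := ih s' hs'
        exact ⟨e, .head hs' he, hend⟩
      · exact ⟨s, .refl, not_exists.1 h⟩
  obtain ⟨⟨t, L⟩, h, hend⟩ := key ⟨0, []⟩
  exact ⟨L, t, h, hend⟩

/-! ### Feasibility -/

/-- The runs made up to the current time satisfy all requirements of a schedule except
that every job be completed. -/
structure State.Feasible (I : JobInstance) (s : State I.n) : Prop where
  time_nonneg : 0 ≤ s.time
  release_le : ∀ x ∈ s.runs, I.release x.job ≤ x.start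
  start_lt : ∀ x ∈ s.runs, x.start < x.finish
  finish_le : ∀ x ∈ s.runs, x.finish ≤ x.start + 1
  finish_le_time : ∀ x ∈ s.runs, x.finish ≤ s.time
  ordered : s.runs.Pairwise fun x y => x.finish ≤ y.start
  not_again : s.runs.Pairwise fun x y => x.Completes → y.job ≠ x.job

lemma State.Feasible.append {I : JobInstance} {s : State I.n} (hs : s.Feasible I) {j : Fin I.n}
    (hj : Waiting I s j) {t : ℝ} (h1 : s.time < t) (h2 : t ≤ s.time + 1) :
    State.Feasible I ⟨t, s.runs ++ [⟨j, s.time, t⟩]⟩ where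
  time_nonneg := hs.time_nonneg.trans h1.le
  release_le := by
    simp only [List.forall_mem_append, List.forall_mem_singleton]
    exact ⟨hs.release_le, hj.1⟩
  start_lt := by
    simp only [List.forall_mem_append, List.forall_mem_singleton]
    exact ⟨hs.start_lt, h1⟩
  finish_le := by
    simp only [List.forall_mem_append, List.forall_mem_singleton]
    exact ⟨hs.finish_le, h2⟩
  finish_le_time := by
    simp only [List.forall_mem_append, List.forall_mem_singleton]
    exact ⟨fun x hx => (hs.finish_le_time x hx).trans h1.le, le_rfl⟩
  ordered := by
    simp only [List.pairwise_append, List.pairwise_singleton, List.forall_mem_singleton, true_and]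
    exact ⟨hs.ordered, hs.finish_le_time⟩
  not_again := by
    simp only [List.pairwise_append, List.pairwise_singleton, List.forall_mem_singleton, true_and]
    exact ⟨hs.not_again, fun x hx hc he => hj.2 ⟨x, hx, he.symm, hc⟩⟩

lemma Step.feasible {R : ℝ} (hR : 1 < R) {I : JobInstance} {s s' : State I.n}
    (h : Step R I s s') (hs : s.Feasible I) : s'.Feasible I := by
  have ht := h.time_lt
  cases h with
  | idle i =>
    exact ⟨I.release_nonneg i, hs.release_le, hs.start_lt, hs.finish_le,
      fun x hx => (hs.finish_le_time x hx).trans ht.le, hs.ordered, hs.not_again⟩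
  | complete j hj _ => exact hs.append hj.1 ht le_rfl
  | interrupt j i hj hi _ =>
    exact hs.append hj.1 ht (hi.2.2.2.le.trans (phaseEnd_lt_add_one hR hs.time_nonneg).le)

lemma feasible_of_reachable {R : ℝ} (hR : 1 < R) {I : JobInstance} {s : State I.n}
    (h : Relation.ReflTransGen (Step R I) ⟨0, []⟩ s) : s.Feasible I := by
  induction h with
  | refl => constructor <;> simp
  | tail _ hst ih => exact hst.feasible hR ih

lemma IsLLWSchedule.isSchedule {R : ℝ} (hR : 1 < R) {I : JobInstance} {L : List (Run I.n)}
    (h : IsLLWSchedule R I L) : IsSchedule I L := by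
  obtain ⟨t, hreach, hend⟩ := h
  have hs := feasible_of_reachable hR hreach
  refine ⟨hs.release_le, hs.start_lt, hs.finish_le, hs.ordered, hs.not_again, ?_⟩
  by_contra! hc
  obtain ⟨s', hs'⟩ := exists_step R I ⟨t, L⟩ hc
  exact hend s' hs'

/-! ### Completion times and a lower bound on the optimum -/

lemma _root_.List.Pairwise.or_of_mem {α : Type*} {r : α → α → Prop} {L : List α}
    (hL : L.Pairwise r) {x y : α} (hx : x ∈ L) (hy : y ∈ L) (hxy : x ≠ y) : r x y ∨ r y x := by
  obtain ⟨i, hi, rfl⟩ := List.getElem_of_mem hx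
  obtain ⟨j, hj, rfl⟩ := List.getElem_of_mem hy
  rw [List.pairwise_iff_getElem] at hL
  rcases lt_trichotomy i j with h | rfl | h
  · exact Or.inl (hL i j hi hj h)
  · exact absurd rfl hxy
  · exact Or.inr (hL j i hj hi h)

lemma completionTime_eq {n : ℕ} {L : List (Run n)}
    (hL : L.Pairwise fun x y => x.Completes → y.job ≠ x.job) {x : Run n} (hx : x ∈ L)
    (hc : x.Completes) : completionTime L x.job = x.finish := by
  have : {c | ∃ y ∈ L, y.job = x.job ∧ y.Completes ∧ y.finish = c} = {x.finish} := by
    ext c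
    constructor
    · rintro ⟨y, hy, hj, hyc, rfl⟩
      by_cases hxy : x = y
      · rw [hxy]; rfl
      rcases hL.or_of_mem hx hy hxy with h | h
      · exact absurd hj (h hc)
      · exact absurd hj.symm (h hyc)
    · rintro rfl
      exact ⟨x, hx, rfl, hc, rfl⟩
  rw [completionTime, this, csInf_singleton]

lemma exists_add_card_le {ι : Type*} {S : Finset ι} (hS : S.Nonempty) {g : ι → ℝ} {ρ : ℝ}
    (hρ : ∀ j ∈ S, ρ + 1 ≤ g j)
    (hsep : ∀ i ∈ S, ∀ j ∈ S, i ≠ j → g i + 1 ≤ g j ∨ g j + 1 ≤ g i) :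
    ∃ j ∈ S, ρ + S.card ≤ g j := by
  classical
  induction S using Finset.induction_on_max_value g with
  | empty => simp at hS
  | insert a s ha hmax ih =>
    refine ⟨a, Finset.mem_insert_self a s, ?_⟩
    rw [Finset.card_insert_of_notMem ha]
    push_cast
    rcases s.eq_empty_or_nonempty with rfl | hs
    · simpa using hρ a (by simp)
    · obtain ⟨j, hj, hle⟩ := ih hs (fun i hi => hρ i (Finset.mem_insert_of_mem hi))
        fun i hi k hk => hsep i (Finset.mem_insert_of_mem hi) k (Finset.mem_insert_of_mem hk)
      have hne : j ≠ a := fun h => ha (h ▸ hj)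
      have := hmax j hj
      rcases hsep j (Finset.mem_insert_of_mem hj) a (Finset.mem_insert_self a s) hne with h | h <;>
        linarith

/-- Of the jobs in `S`, the one completed last completes at time `ρ + |S|` at the earliest. -/
lemma IsSchedule.le_weightedMakespan {I : JobInstance} {L : List (Run I.n)} (hL : IsSchedule I L)
    {S : Finset (Fin I.n)} (hS : S.Nonempty) {w ρ : ℝ} (hρ0 : 0 ≤ ρ)
    (hw : ∀ j ∈ S, w ≤ I.weight j) (hρ : ∀ j ∈ S, ρ ≤ I.release j) :
    w * (ρ + S.card) ≤ weightedMakespan I L := by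
  choose x hx hxj hxc using hL.all_completed
  obtain ⟨j, hj, hle⟩ := exists_add_card_le hS (g := fun j => (x j).finish) (ρ := ρ)
    (fun j hj => by
      have h1 := hL.release_le _ (hx j)
      have h2 : (x j).finish = (x j).start + 1 := hxc j
      rw [hxj] at h1
      have := hρ j hj
      linarith)
    (fun i _ j _ hij => by
      have hne : x i ≠ x j := fun h => hij (by rw [← hxj i, ← hxj j, h])
      have h1 : (x i).finish = (x i).start + 1 := hxc i
      have h2 : (x j).finish = (x j).start + 1 := hxc j
      rcases hL.ordered.or_of_mem (hx i) (hx j) hne with h | h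
      · left; linarith
      · right; linarith)
  have hfin : completionTime L j = (x j).finish := by
    conv_lhs => rw [← hxj j]
    exact completionTime_eq hL.not_again (hx j) (hxc j)
  calc w * (ρ + S.card) ≤ I.weight j * (ρ + S.card) := by
        gcongr
        exact hw j hj
    _ ≤ I.weight j * completionTime L j := by
        rw [hfin]
        exact mul_le_mul_of_nonneg_left hle (I.weight_pos j).le
    _ ≤ weightedMakespan I L :=
        le_ciSup (f := fun j => I.weight j * completionTime L j) (Set.finite_range _).bddAbove j

lemma le_opt {I : JobInstance} {S : Finset (Fin I.n)} (hS : S.Nonempty) {w ρ : ℝ} (hρ0 : 0 ≤ ρ)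
    (hw : ∀ j ∈ S, w ≤ I.weight j) (hρ : ∀ j ∈ S, ρ ≤ I.release j) :
    w * (ρ + S.card) ≤ opt I := by
  refine le_csInf ?_ ?_
  · -- any parameter greater than `1` makes the algorithm produce a feasible schedule
    obtain ⟨L, hL⟩ := exists_isLLWSchedule 2 I
    exact ⟨_, L, hL.isSchedule one_lt_two, rfl⟩
  · rintro _ ⟨L, hL, rfl⟩
    exact hL.le_weightedMakespan hS hρ0 hw hρ

lemma opt_pos (I : JobInstance) : 0 < opt I := by
  have h := le_opt (Finset.singleton_nonempty (⟨0, I.n_pos⟩ : Fin I.n)) le_rfl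
    (w := I.weight ⟨0, I.n_pos⟩) (by simp) (by simpa using I.release_nonneg _)
  have := I.weight_pos ⟨0, I.n_pos⟩
  simp only [Finset.card_singleton, Nat.cast_one, zero_add, mul_one] at h
  linarith

lemma opt_le {I : JobInstance} {L : List (Run I.n)} (hL : IsSchedule I L) :
    opt I ≤ weightedMakespan I L := by
  refine csInf_le ⟨0, ?_⟩ ⟨L, hL, rfl⟩
  rintro _ ⟨L', hL', rfl⟩
  refine le_trans ?_ (hL'.le_weightedMakespan (Finset.singleton_nonempty ⟨0, I.n_pos⟩) le_rfl
    (w := 0) (by simpa using (I.weight_pos _).le) (by simpa using I.release_nonneg _))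
  simp

/-! ### Competitiveness -/

open Classical in
/-- The waiting jobs of weight at least `w`. -/
noncomputable def heavyWaiting (I : JobInstance) (w : ℝ) (s : State I.n) : Finset (Fin I.n) :=
  Finset.univ.filter fun j => w ≤ I.weight j ∧ Waiting I s j

lemma mem_heavyWaiting {I : JobInstance} {w : ℝ} {s : State I.n} {j : Fin I.n} :
    j ∈ heavyWaiting I w s ↔ w ≤ I.weight j ∧ Waiting I s j := by
  simp [heavyWaiting]

/-- In state `s` the algorithm is in the middle of a block, i.e. a period in which it runs only jobs
of weight at least `w`. The set `A` consists of the jobs completed in the block, and all jobs of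
weight at least `w` that were not completed before the block are released at time `ρ` or later.

With `q` waiting jobs of weight at least `w`, the time at which all of them could be completed,
were there no further interruption, is `s.time + q`; by `bound` it is at most `R` times the lower
bound `ρ + |A| + q` for the last completion of these jobs in any schedule. An interruption that
starts at a time `t` with `2 - R ^ 2 ≤ (R - 1) * t` wastes at most `R - 1` time units, which the
newly arrived job pays for. For earlier ones, `early` records how many jobs are waiting: one
more than the number of interruptions in the block, as long as there are at most two of them. -/
structure InBlock (R w : ℝ) (I : JobInstance) (s : State I.n) (ρ : ℝ) (A : Finset (Fin I.n)) :
    Prop where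
  nonneg : 0 ≤ ρ
  weight_le : ∀ j ∈ A, w ≤ I.weight j
  completed : ∀ j ∈ A, Completed s.runs j
  le_release : ∀ j ∈ A, ρ ≤ I.release j
  le_release_of_not_completed : ∀ j, w ≤ I.weight j → ¬ Completed s.runs j → ρ ≤ I.release j
  bound : s.time + (heavyWaiting I w s).card ≤ R * (ρ + A.card + (heavyWaiting I w s).card)
  early : 2 - R ^ 2 ≤ (R - 1) * s.time ∨ s.time = ρ ∨
    s.time ≤ phaseEnd R ρ ∧ 2 ≤ (heavyWaiting I w s).card ∨ 3 ≤ (heavyWaiting I w s).card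

/-- Either no job of weight at least `w` is waiting, or the state belongs to a block. -/
def BlockInvariant (R w : ℝ) (I : JobInstance) (s : State I.n) : Prop :=
  heavyWaiting I w s = ∅ ∨ ∃ ρ A, InBlock R w I s ρ A

lemma InBlock.of_time_eq {R w : ℝ} (hR : 1 < R) {I : JobInstance} {s : State I.n}
    (h0 : 0 ≤ s.time)
    (h : ∀ j, w ≤ I.weight j → ¬ Completed s.runs j → s.time ≤ I.release j) :
    InBlock R w I s s.time ∅ where
  nonneg := h0
  weight_le := by simp
  completed := by simp
  le_release := by simp
  le_release_of_not_completed := h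
  bound := by
    have : (0 : ℝ) ≤ (heavyWaiting I w s).card := by positivity
    simp only [Finset.card_empty, Nat.cast_zero, add_zero]
    exact le_mul_of_one_le_left (by linarith) hR.le
  early := Or.inr (Or.inl rfl)

/-- A job `k` of weight less than `w` is completed. It was not interrupted, so the jobs of weight
at least `w` arrive at the end of its phase or later, unless it was started at a time
when the algorithm no longer interrupts. -/
lemma blockInvariant_of_complete_light {R w : ℝ} (hR : 1 < R)
    {I : JobInstance} {s : State I.n} (h0 : 0 ≤ s.time) {k : Fin I.n}
    (hk : HeaviestWaiting I s k) (hkw : I.weight k < w)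
    (hun : ∀ i, ¬ Challenges R I s.time k i) (hR2 : 2 < R ^ 2 + (R - 1)) (hR3 : R < 2) :
    BlockInvariant R w I ⟨s.time + 1, s.runs ++ [⟨k, s.time, s.time + 1⟩]⟩ := by
  set s' : State I.n := ⟨s.time + 1, s.runs ++ [⟨k, s.time, s.time + 1⟩]⟩ with hs'
  rcases (heavyWaiting I w s').eq_empty_or_nonempty with he | hne
  · exact Or.inl he
  have hq : (1 : ℝ) ≤ (heavyWaiting I w s').card := by exact_mod_cast hne.card_pos
  have hrel : ∀ j, w ≤ I.weight j → ¬ Completed s'.runs j → s.time < I.release j := by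
    intro j hj hc
    refine lt_release_of_not_waiting (fun hjw => ?_) (fun h => hc (completed_append_singleton.2
      (Or.inl h)))
    linarith [hk.2 j hjw]
  have hearly : 2 - R ^ 2 ≤ (R - 1) * s'.time := by
    simp only [hs']
    nlinarith
  right
  by_cases ht : s.time < noInterruptTime R
  · have hpe := mul_phaseEnd (R := R) (by linarith) s.time
    have hpe0 : 0 ≤ phaseEnd R s.time := by
      by_contra! hneg
      nlinarith
    refine ⟨phaseEnd R s.time, ∅, hpe0, by simp, by simp, by simp, ?_, ?_, Or.inl hearly⟩
    · intro j hj hc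
      by_contra! hlt
      exact hun j ⟨ht, hkw.trans_le hj, hrel j hj hc, hlt⟩
    · simp only [Finset.card_empty, Nat.cast_zero, add_zero, mul_add, hpe]
      simp only [hs'] at hq ⊢
      nlinarith
  · have ht' : 2 - R ≤ s.time * (R - 1) := by
      rwa [noInterruptTime, not_lt, div_le_iff₀ (by linarith)] at ht
    refine ⟨s.time, ∅, h0, by simp, by simp, by simp, fun j hj hc => (hrel j hj hc).le, ?_,
      Or.inl hearly⟩
    simp only [Finset.card_empty, Nat.cast_zero, add_zero]
    simp only [hs'] at hq ⊢
    nlinarith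

/-- A job `k` of weight at least `w` is completed. -/
lemma InBlock.complete {R w : ℝ} (hR : 1 < R) (hR2 : 2 < R ^ 2 + (R - 1)) {I : JobInstance}
    {s : State I.n} (h0 : 0 ≤ s.time)
    {ρ : ℝ} {A : Finset (Fin I.n)} (hA : InBlock R w I s ρ A) {k : Fin I.n}
    (hk : Waiting I s k) (hkw : w ≤ I.weight k) :
    InBlock R w I ⟨s.time + 1, s.runs ++ [⟨k, s.time, s.time + 1⟩]⟩ ρ (insert k A) where
  nonneg := hA.nonneg
  weight_le := by
    simp only [Finset.forall_mem_insert]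
    exact ⟨hkw, hA.weight_le⟩
  completed := by
    simp only [Finset.forall_mem_insert, completed_append_singleton]
    exact ⟨Or.inr ⟨trivial, rfl⟩, fun j hj => Or.inl (hA.completed j hj)⟩
  le_release := by
    simp only [Finset.forall_mem_insert]
    exact ⟨hA.le_release_of_not_completed k hkw hk.2, hA.le_release⟩
  le_release_of_not_completed := fun j hj hc =>
    hA.le_release_of_not_completed j hj fun h => hc (completed_append_singleton.2 (Or.inl h))
  bound := by
    set s' : State I.n := ⟨s.time + 1, s.runs ++ [⟨k, s.time, s.time + 1⟩]⟩ with hs'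
    have hsub : heavyWaiting I w s ⊆ insert k (heavyWaiting I w s') := by
      intro j hj
      rw [mem_heavyWaiting] at hj
      rw [Finset.mem_insert, mem_heavyWaiting]
      by_cases hjk : j = k
      · exact Or.inl hjk
      · refine Or.inr ⟨hj.1, by simp only [hs']; linarith [hj.2.1], ?_⟩
        simp only [hs', completed_append_singleton, not_or]
        exact ⟨hj.2.2, fun h => hjk h.1.symm⟩
    have hcard : ((heavyWaiting I w s).card : ℝ) ≤ (heavyWaiting I w s').card + 1 := by
      exact_mod_cast (Finset.card_le_card hsub).trans (Finset.card_insert_le _ _)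
    rw [Finset.card_insert_of_notMem fun h => hk.2 (hA.completed k h)]
    have hb := hA.bound
    simp only [hs'] at hcard ⊢
    push_cast
    nlinarith
  early := by
    left
    simp only
    nlinarith

/-- A job `k` of weight at least `w` is interrupted by the arrival of job `i`. The first two
interruptions of a block end at `phaseEnd R ρ` and `phaseEnd R (phaseEnd R ρ)` at the latest; for
the second one and `ρ = 0`, the bound is sharp by the equation that defines `R`. -/
lemma InBlock.interrupt {R w : ℝ} (hR0 : 3 * R ^ 3 - 2 * R ^ 2 - R - 2 = 0) (hlo : 1.3097 < R)
    (hhi : R < 1.3098) {I : JobInstance} {s : State I.n}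
    {ρ : ℝ} {A : Finset (Fin I.n)} (hA : InBlock R w I s ρ A) {k i : Fin I.n}
    (hk : Waiting I s k) (hkw : w ≤ I.weight k) (hi : Challenges R I s.time k i)
    (hic : ¬ Completed s.runs i) (hlen : I.release i < s.time + 1) :
    InBlock R w I ⟨I.release i, s.runs ++ [⟨k, s.time, I.release i⟩]⟩ ρ A := by
  set s' : State I.n := ⟨I.release i, s.runs ++ [⟨k, s.time, I.release i⟩]⟩ with hs'
  obtain ⟨-, hwt, hgt, hlt⟩ := hi
  have hcompl : ∀ j, Completed s'.runs j ↔ Completed s.runs j := by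
    intro j
    simp only [hs', completed_append_singleton, or_iff_left_iff_imp, and_imp]
    intro _ h
    exact absurd h hlen.ne
  have hiH : i ∉ heavyWaiting I w s := fun h => by
    linarith [(mem_heavyWaiting.1 h).2.1]
  have hsub : insert i (heavyWaiting I w s) ⊆ heavyWaiting I w s' := by
    intro j hj
    rw [Finset.mem_insert, mem_heavyWaiting] at hj
    rw [mem_heavyWaiting, Waiting, hcompl]
    rcases hj with rfl | hj
    · exact ⟨hkw.trans hwt.le, le_rfl, hic⟩
    · exact ⟨hj.1, hj.2.1.trans hgt.le, hj.2.2⟩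
  have hcardN : (heavyWaiting I w s).card + 1 ≤ (heavyWaiting I w s').card := by
    rw [← Finset.card_insert_of_notMem hiH]
    exact Finset.card_le_card hsub
  have hq1 : 1 ≤ (heavyWaiting I w s).card :=
    Finset.card_pos.2 ⟨k, mem_heavyWaiting.2 ⟨hkw, hk⟩⟩
  have hcard : ((heavyWaiting I w s).card : ℝ) + 1 ≤ (heavyWaiting I w s').card := by
    exact_mod_cast hcardN
  have hAc : (0 : ℝ) ≤ A.card := by positivity
  have hρ := hA.nonneg
  have hpe := mul_phaseEnd (R := R) (by linarith) s.time
  have hpρ := mul_phaseEnd (R := R) (by linarith) ρ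
  have hs't : s'.time = I.release i := rfl
  have hRlt : R * I.release i < s.time + 2 - R := by
    rw [← hpe]
    exact mul_lt_mul_of_pos_left hlt (by linarith)
  have reduce : ∀ m : ℝ, m ≤ (heavyWaiting I w s').card → s'.time ≤ R * ρ + (R - 1) * m →
      s'.time + (heavyWaiting I w s').card ≤ R * (ρ + A.card + (heavyWaiting I w s').card) := by
    intro m hm h
    nlinarith [mul_le_mul_of_nonneg_left hm (show 0 ≤ R - 1 by linarith),
      mul_nonneg (show 0 ≤ R by linarith) hAc]
  have hbound : s'.time + (heavyWaiting I w s').card ≤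
      R * (ρ + A.card + (heavyWaiting I w s').card) := by
    by_cases hlate : 2 - R ^ 2 ≤ (R - 1) * s.time
    · -- the interruption wastes at most `R - 1` time units
      have hwaste : s'.time ≤ s.time + (R - 1) := by
        rw [hs't]
        by_contra! hcon
        nlinarith
      have hb := hA.bound
      nlinarith
    · rcases hA.early with h | h | ⟨h, hq⟩ | hq
      · exact absurd h hlate
      · refine reduce 2 ?_ ?_
        · exact_mod_cast (show 2 ≤ (heavyWaiting I w s').card by omega)
        · rw [hs't]
          nlinarith
      · refine reduce 3 ?_ ?_
        · exact_mod_cast (show 3 ≤ (heavyWaiting I w s').card by omega)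
        · rw [hs't]
          have h1 : R * (R * I.release i) ≤ ρ + 2 - R + R * (2 - R) := by
            nlinarith
          have h2 : R * (R * (R * ρ + (R - 1) * 3)) = R ^ 3 * ρ + 2 + R - R ^ 2 := by
            linear_combination hR0
          have h3 : 0 ≤ (R ^ 3 - 1) * ρ := mul_nonneg (by nlinarith) hρ
          by_contra! hcon
          have h4 := mul_lt_mul_of_pos_left
            (mul_lt_mul_of_pos_left hcon (show 0 < R by linarith)) (show 0 < R by linarith)
          nlinarith
      · refine reduce 4 ?_ ?_
        · exact_mod_cast (show 4 ≤ (heavyWaiting I w s').card by omega)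
        · rw [hs't]
          push Not at hlate
          have : s.time < 0.921 := by
            by_contra! hcon
            nlinarith
          nlinarith
  refine ⟨hρ, hA.weight_le, fun j hj => (hcompl j).2 (hA.completed j hj), hA.le_release,
    fun j hj hc => hA.le_release_of_not_completed j hj (mt (hcompl j).2 hc), hbound, ?_⟩
  rcases hA.early with h | h | ⟨h, hq⟩ | hq
  · left
    rw [hs't]
    nlinarith
  · rw [h] at hlt
    exact Or.inr (Or.inr (Or.inl ⟨hlt.le, by omega⟩))
  · exact Or.inr (Or.inr (Or.inr (by omega)))
  · exact Or.inr (Or.inr (Or.inr (by omega)))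

lemma Step.blockInvariant {R w : ℝ} (hR0 : 3 * R ^ 3 - 2 * R ^ 2 - R - 2 = 0) (hlo : 1.3097 < R)
    (hhi : R < 1.3098) {I : JobInstance} {s s' : State I.n} (h : Step R I s s')
    (hs : s.Feasible I) (hinv : BlockInvariant R w I s) : BlockInvariant R w I s' := by
  have hR1 : 1 < R := by linarith
  have hR2 : 2 < R ^ 2 + (R - 1) := by nlinarith
  have h0' : 0 ≤ s'.time := hs.time_nonneg.trans h.time_lt.le
  have block : ∀ {k}, Waiting I s k → w ≤ I.weight k → ∃ ρ A, InBlock R w I s ρ A := by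
    intro k hk hkw
    refine hinv.resolve_left (Finset.nonempty_iff_ne_empty.1 ⟨k, mem_heavyWaiting.2 ⟨hkw, hk⟩⟩)
  cases h with
  | idle i hn hi hnext =>
    exact Or.inr ⟨_, ∅, InBlock.of_time_eq hR1 h0' fun j _ hj => hnext j hj⟩
  | complete k hk hun =>
    rcases lt_or_ge (I.weight k) w with hkw | hkw
    · exact blockInvariant_of_complete_light hR1 hs.time_nonneg hk hkw hun hR2 (by linarith)
    · obtain ⟨ρ, A, hA⟩ := block hk.1 hkw
      exact Or.inr ⟨ρ, _, hA.complete hR1 hR2 hs.time_nonneg hk.1 hkw⟩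
  | interrupt k i hk hi hfirst =>
    have hlen : I.release i < s.time + 1 :=
      hi.2.2.2.trans (phaseEnd_lt_add_one hR1 hs.time_nonneg)
    rcases lt_or_ge (I.weight k) w with hkw | hkw
    · -- the first job of weight at least `w` to arrive is not earlier than the challenger `i`
      refine Or.inr ⟨_, ∅, InBlock.of_time_eq hR1 h0' fun j hj hc => ?_⟩
      have hjt : s.time < I.release j := by
        refine lt_release_of_not_waiting (fun hjw => ?_)
          (fun h => hc (completed_append_singleton.2 (Or.inl h)))
        linarith [hk.2 j hjw]
      by_contra! hlt
      exact absurd (hfirst j ⟨hi.1, hkw.trans_le hj, hjt, hlt.trans hi.2.2.2⟩) (not_le.2 hlt)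
    · obtain ⟨ρ, A, hA⟩ := block hk.1 hkw
      refine Or.inr ⟨ρ, A, hA.interrupt hR0 hlo hhi hk.1 hkw hi ?_ hlen⟩
      -- a job released in the future is not completed
      rintro ⟨x, hx, rfl, -⟩
      linarith [hs.release_le x hx, hs.start_lt x hx, hs.finish_le_time x hx, hi.2.2.1]

/-- If the algorithm starts and completes job `j`, then the waiting jobs of at least its weight
and the jobs completed in the current block bound the optimum. -/
lemma BlockInvariant.mul_le_opt {R : ℝ} (hR : 1 < R) {I : JobInstance} {s : State I.n}
    {j : Fin I.n} (hinv : BlockInvariant R (I.weight j) I s) (hj : Waiting I s j) :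
    I.weight j * (s.time + 1) ≤ R * opt I := by
  classical
  have hjH : j ∈ heavyWaiting I (I.weight j) s := mem_heavyWaiting.2 ⟨le_rfl, hj⟩
  obtain ⟨ρ, A, hA⟩ := hinv.resolve_left (Finset.nonempty_iff_ne_empty.1 ⟨j, hjH⟩)
  have hdisj : Disjoint A (heavyWaiting I (I.weight j) s) :=
    Finset.disjoint_left.2 fun i hi hiH => (mem_heavyWaiting.1 hiH).2.2 (hA.completed i hi)
  have hopt := le_opt (I := I) (S := A ∪ heavyWaiting I (I.weight j) s) (w := I.weight j)
    ⟨j, Finset.mem_union_right _ hjH⟩ hA.nonneg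
    (fun i hi => (Finset.mem_union.1 hi).elim (hA.weight_le i)
      fun h => (mem_heavyWaiting.1 h).1)
    (fun i hi => (Finset.mem_union.1 hi).elim (hA.le_release i)
      fun h => hA.le_release_of_not_completed i (mem_heavyWaiting.1 h).1
        (mem_heavyWaiting.1 h).2.2)
  rw [Finset.card_union_of_disjoint hdisj] at hopt
  push_cast at hopt
  have hq : (1 : ℝ) ≤ (heavyWaiting I (I.weight j) s).card := by
    exact_mod_cast Finset.card_pos.2 ⟨j, hjH⟩
  calc I.weight j * (s.time + 1)
      ≤ I.weight j * (R * (ρ + A.card + (heavyWaiting I (I.weight j) s).card)) :=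
        mul_le_mul_of_nonneg_left (by linarith [hA.bound]) (I.weight_pos j).le
    _ = R * (I.weight j * (ρ + (A.card + (heavyWaiting I (I.weight j) s).card))) := by ring
    _ ≤ R * opt I := mul_le_mul_of_nonneg_left hopt (by linarith)

lemma weight_mul_finish_le {R : ℝ} (hR0 : 3 * R ^ 3 - 2 * R ^ 2 - R - 2 = 0) (hlo : 1.3097 < R)
    (hhi : R < 1.3098) {I : JobInstance} {s : State I.n}
    (h : Relation.ReflTransGen (Step R I) ⟨0, []⟩ s) :
    (∀ w, BlockInvariant R w I s) ∧
      ∀ x ∈ s.runs, x.Completes → I.weight x.job * x.finish ≤ R * opt I := by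
  have hR1 : 1 < R := by linarith
  induction h with
  | refl =>
    exact ⟨fun w => Or.inr ⟨0, ∅, InBlock.of_time_eq hR1 le_rfl fun j _ _ => I.release_nonneg j⟩,
      by simp⟩
  | @tail s s' hreach hst ih =>
    have hs := feasible_of_reachable hR1 hreach
    refine ⟨fun w => hst.blockInvariant hR0 hlo hhi hs (ih.1 w), ?_⟩
    cases hst with
    | idle => exact ih.2
    | complete k hk _ =>
      simp only [List.forall_mem_append, List.forall_mem_singleton]
      exact ⟨ih.2, fun _ => (ih.1 _).mul_le_opt hR1 hk.1⟩
    | interrupt k i hk hi _ =>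
      simp only [List.forall_mem_append, List.forall_mem_singleton]
      refine ⟨ih.2, fun h => absurd h ?_⟩
      exact (hi.2.2.2.trans (phaseEnd_lt_add_one hR1 hs.time_nonneg)).ne

lemma llwCompetitive {R : ℝ} (hR0 : 3 * R ^ 3 - 2 * R ^ 2 - R - 2 = 0) (hlo : 1.3097 < R)
    (hhi : R < 1.3098) : LLWCompetitive R R := by
  intro I L hL
  have hsch := hL.isSchedule (by linarith)
  obtain ⟨t, hreach, -⟩ := hL
  have : Nonempty (Fin I.n) := ⟨⟨0, I.n_pos⟩⟩
  refine ciSup_le fun j => ?_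
  obtain ⟨x, hx, rfl, hc⟩ := hsch.all_completed j
  rw [completionTime_eq hsch.not_again hx hc]
  exact (weight_mul_finish_le hR0 hlo hhi hreach).2 x hx hc

/-! ### Tightness -/

/-- Three jobs `0`, `1`, `2` of slightly increasing weights `1`, `1 + ε`, `1 + 2 * ε`, which arrive
at the times `0`, `a`, `b`. -/
noncomputable def tightInstance (a b ε : ℝ) (ha : 0 < a) (hb : 0 < b) (hε : 0 < ε) :
    JobInstance where
  n := 3
  n_pos := by norm_num
  release := ![0, a, b]
  weight := ![1, 1 + ε, 1 + 2 * ε]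
  release_nonneg := by
    intro j
    fin_cases j
    · exact le_rfl
    · exact ha.le
    · exact hb.le
  weight_pos := by
    intro j
    fin_cases j
    · exact one_pos
    · exact (by linarith : 0 < 1 + ε)
    · exact (by linarith : 0 < 1 + 2 * ε)

/-- If one waiting job is heavier than all others, the algorithm has no choice. -/
lemma Step.of_strictly_heaviest {R : ℝ} {I : JobInstance} {s s' : State I.n} (h : Step R I s s')
    {k : Fin I.n} (hk : Waiting I s k)
    (hmax : ∀ i, Waiting I s i → i ≠ k → I.weight i < I.weight k) :
    ((∀ i, ¬ Challenges R I s.time k i) ∧ s' = ⟨s.time + 1, s.runs ++ [⟨k, s.time, s.time + 1⟩]⟩) ∨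
    ∃ i, Challenges R I s.time k i ∧
      (∀ i', Challenges R I s.time k i' → I.release i ≤ I.release i') ∧
      s' = ⟨I.release i, s.runs ++ [⟨k, s.time, I.release i⟩]⟩ := by
  have huniq : ∀ {j}, HeaviestWaiting I s j → j = k := by
    intro j hj
    by_contra hjk
    exact absurd (hmax j hj.1 hjk) (not_lt.2 (hj.2 k hk))
  cases h with
  | idle i hn => exact absurd hk (hn k)
  | complete j hj hun =>
    obtain rfl := huniq hj
    exact Or.inl ⟨hun, rfl⟩
  | interrupt j i hj hi hfirst =>
    obtain rfl := huniq hj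
    exact Or.inr ⟨i, hi, hfirst, rfl⟩

section Tight

variable {R a b ε : ℝ} {ha : 0 < a} {hb : 0 < b} {hε : 0 < ε}

/-- The states that the algorithm can reach on the tight instance, up to the completion of job
`0`: jobs `0` and `1` are interrupted at the times `a` and `b`, and from time `b` on, the jobs
`2`, `1`, `0` are completed in this order. -/
def TightInvariant (ha : 0 < a) (hb : 0 < b) (hε : 0 < ε)
    (s : State (tightInstance a b ε ha hb hε).n) : Prop :=
  (s.time = 0 ∧ ∀ i : Fin 3, ¬ Completed s.runs i) ∨
  (s.time = a ∧ ∀ i : Fin 3, ¬ Completed s.runs i) ∨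
  (s.time = b ∧ ∀ i : Fin 3, ¬ Completed s.runs i) ∨
  (s.time = b + 1 ∧ ∀ i : Fin 3, Completed s.runs i ↔ i = 2) ∨
  (s.time = b + 2 ∧ ∀ i : Fin 3, Completed s.runs i ↔ i ≠ 0) ∨
  ∃ x ∈ s.runs, x.job = (0 : Fin 3) ∧ x.Completes ∧ x.finish = b + 3

lemma Step.tightInvariant (hab : a < b) (haR : a < phaseEnd R 0) (hbR : b < phaseEnd R a)
    (hb1 : b < 1) (haT : a < noInterruptTime R)
    {s s' : State (tightInstance a b ε ha hb hε).n}
    (h : Step R (tightInstance a b ε ha hb hε) s s') (hs : TightInvariant ha hb hε s) :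
    TightInvariant ha hb hε s' := by
  let I := tightInstance a b ε ha hb hε
  have r0 : I.release (0 : Fin 3) = 0 := rfl
  have r1 : I.release (1 : Fin 3) = a := rfl
  have r2 : I.release (2 : Fin 3) = b := rfl
  have w0 : I.weight (0 : Fin 3) = 1 := rfl
  have w1 : I.weight (1 : Fin 3) = 1 + ε := rfl
  have w2 : I.weight (2 : Fin 3) = 1 + 2 * ε := rfl
  -- once the time has reached `b`, there are no challengers
  have late : ∀ t, b ≤ t → ∀ k i : Fin 3, ¬ Challenges R I t k i := by
    rintro t ht k i ⟨-, -, h3, -⟩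
    fin_cases i
    · linarith [show I.release (0 : Fin 3) > t from h3]
    · linarith [show I.release (1 : Fin 3) > t from h3]
    · linarith [show I.release (2 : Fin 3) > t from h3]
  rcases hs with ⟨ht, hc⟩ | ⟨ht, hc⟩ | ⟨ht, hc⟩ | ⟨ht, hc⟩ | ⟨ht, hc⟩ | ⟨x, hx, hx'⟩
  · have hk : Waiting I s (0 : Fin 3) := ⟨by rw [r0, ht], hc 0⟩
    have hmax : ∀ i : Fin 3, Waiting I s i → i ≠ 0 → I.weight i < I.weight (0 : Fin 3) := by
      intro i hi hi0
      have := hi.1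
      fin_cases i
      · exact absurd rfl hi0
      · linarith [show I.release (1 : Fin 3) ≤ s.time from this]
      · linarith [show I.release (2 : Fin 3) ≤ s.time from this]
    have hch : Challenges R I s.time (0 : Fin 3) (1 : Fin 3) := by
      refine ⟨?_, ?_, ?_, ?_⟩ <;> (try rw [ht]) <;> (try rw [r1]) <;> (try rw [w0, w1]) <;> linarith
    rcases h.of_strictly_heaviest hk hmax with ⟨hun, -⟩ | ⟨i, hi, hfirst, rfl⟩
    · exact absurd hch (hun _)
    · have hia : I.release i = a := by
        have hle := hfirst _ hch
        have hlt := hi.2.1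
        change Fin 3 at i
        fin_cases i
        · exact absurd hlt (lt_irrefl _)
        · rfl
        · linarith [show I.release (2 : Fin 3) ≤ a from hle]
      refine Or.inr (Or.inl ⟨hia, fun i' hi' => ?_⟩)
      rcases (completed_append_singleton (n := 3)).1 hi' with h' | h'
      · exact hc i' h'
      · linarith [show I.release i = s.time + 1 from h'.2]
  · have hk : Waiting I s (1 : Fin 3) := ⟨by rw [r1, ht], hc 1⟩
    have hmax : ∀ i : Fin 3, Waiting I s i → i ≠ 1 → I.weight i < I.weight (1 : Fin 3) := by
      intro i hi hi0
      have := hi.1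
      fin_cases i
      · exact (by linarith : I.weight (0 : Fin 3) < I.weight (1 : Fin 3))
      · exact absurd rfl hi0
      · linarith [show I.release (2 : Fin 3) ≤ s.time from this]
    have hch : Challenges R I s.time (1 : Fin 3) (2 : Fin 3) := by
      refine ⟨?_, ?_, ?_, ?_⟩ <;> (try rw [ht]) <;> (try rw [r2]) <;> (try rw [w1, w2]) <;> linarith
    rcases h.of_strictly_heaviest hk hmax with ⟨hun, -⟩ | ⟨i, hi, hfirst, rfl⟩
    · exact absurd hch (hun _)
    · have hib : I.release i = b := by
        have hlt := hi.2.1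
        change Fin 3 at i
        fin_cases i
        · linarith [show I.weight (1 : Fin 3) < I.weight (0 : Fin 3) from hlt]
        · exact absurd hlt (lt_irrefl _)
        · rfl
      refine Or.inr (Or.inr (Or.inl ⟨hib, fun i' hi' => ?_⟩))
      rcases (completed_append_singleton (n := 3)).1 hi' with h' | h'
      · exact hc i' h'
      · linarith [show I.release i = s.time + 1 from h'.2]
  · have hk : Waiting I s (2 : Fin 3) := ⟨by rw [r2, ht], hc 2⟩
    have hmax : ∀ i : Fin 3, Waiting I s i → i ≠ 2 → I.weight i < I.weight (2 : Fin 3) := by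
      intro i _ hi0
      fin_cases i
      · exact (by linarith : I.weight (0 : Fin 3) < I.weight (2 : Fin 3))
      · exact (by linarith : I.weight (1 : Fin 3) < I.weight (2 : Fin 3))
      · exact absurd rfl hi0
    rcases h.of_strictly_heaviest hk hmax with ⟨-, rfl⟩ | ⟨i, hi, -⟩
    · refine Or.inr (Or.inr (Or.inr (Or.inl ⟨by simp only [ht], fun i' => ?_⟩)))
      refine (completed_append_singleton (n := 3)).trans ?_
      exact ⟨fun h => h.elim (fun h => absurd h (hc i')) fun h => h.1.symm,
        fun h => Or.inr ⟨h.symm, rfl⟩⟩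
    · exact absurd hi (late _ ht.ge _ _)
  · have hk : Waiting I s (1 : Fin 3) := ⟨by rw [r1, ht]; linarith, by simp [hc]⟩
    have hmax : ∀ i : Fin 3, Waiting I s i → i ≠ 1 → I.weight i < I.weight (1 : Fin 3) := by
      intro i hi hi0
      have := hi.2
      fin_cases i
      · exact (by linarith : I.weight (0 : Fin 3) < I.weight (1 : Fin 3))
      · exact absurd rfl hi0
      · exact absurd ((hc 2).2 rfl) this
    rcases h.of_strictly_heaviest hk hmax with ⟨-, rfl⟩ | ⟨i, hi, -⟩
    · refine Or.inr (Or.inr (Or.inr (Or.inr (Or.inl ⟨by simp only [ht]; ring, fun i' => ?_⟩))))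
      have hdec : ∀ i : Fin 3, i = 2 ∨ 1 = i ↔ i ≠ 0 := by decide
      exact (completed_append_singleton (n := 3)).trans
        ((or_congr (hc i') (and_iff_left rfl)).trans (hdec i'))
    · exact absurd hi (late _ (by linarith) _ _)
  · have hk : Waiting I s (0 : Fin 3) := ⟨by rw [r0, ht]; linarith, by simp [hc]⟩
    have hmax : ∀ i : Fin 3, Waiting I s i → i ≠ 0 → I.weight i < I.weight (0 : Fin 3) := by
      intro i hi hi0
      exact absurd ((hc i).2 hi0) hi.2
    rcases h.of_strictly_heaviest hk hmax with ⟨-, rfl⟩ | ⟨i, hi, -⟩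
    · refine Or.inr (Or.inr (Or.inr (Or.inr (Or.inr
        ⟨⟨(0 : Fin 3), s.time, s.time + 1⟩, ?_, rfl, rfl, ?_⟩))))
      · simp
      · simp only [ht]
        ring
    · exact absurd hi (late _ (by linarith) _ _)
  · refine Or.inr (Or.inr (Or.inr (Or.inr (Or.inr ⟨x, ?_, hx'⟩))))
    cases h with
    | idle => exact hx
    | complete => exact List.mem_append_left _ hx
    | interrupt => exact List.mem_append_left _ hx

lemma le_weightedMakespan_tightInstance (hR : 1 < R) (hab : a < b) (haR : a < phaseEnd R 0)
    (hbR : b < phaseEnd R a) (hb1 : b < 1) (haT : a < noInterruptTime R)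
    {L : List (Run (tightInstance a b ε ha hb hε).n)}
    (hL : IsLLWSchedule R (tightInstance a b ε ha hb hε) L) :
    b + 3 ≤ weightedMakespan (tightInstance a b ε ha hb hε) L := by
  have hsch := hL.isSchedule hR
  obtain ⟨t, hreach, -⟩ := hL
  have hinv : TightInvariant ha hb hε ⟨t, L⟩ := by
    have hgen : ∀ s, Relation.ReflTransGen (Step R (tightInstance a b ε ha hb hε)) ⟨0, []⟩ s →
        TightInvariant ha hb hε s := by
      intro s hs
      induction hs with
      | refl => exact Or.inl ⟨rfl, by simp [Completed]⟩
      | tail _ hst ih => exact hst.tightInvariant hab haR hbR hb1 haT ih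
    exact hgen _ hreach
  have h0 : Completed L (0 : Fin 3) := hsch.all_completed _
  rcases hinv with ⟨-, h⟩ | ⟨-, h⟩ | ⟨-, h⟩ | ⟨-, h⟩ | ⟨-, h⟩ | ⟨x, hx, hx0, hxc, hxf⟩
  · exact absurd h0 (h 0)
  · exact absurd h0 (h 0)
  · exact absurd h0 (h 0)
  · exact absurd ((h 0).1 h0) (by decide)
  · exact absurd rfl ((h 0).1 h0)
  · refine le_trans (le_of_eq ?_) (le_ciSup (f := fun j =>
      (tightInstance a b ε ha hb hε).weight j * completionTime L j)
      (Set.finite_range _).bddAbove (0 : Fin 3))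
    have hw : (tightInstance a b ε ha hb hε).weight (0 : Fin 3) = 1 := rfl
    have hct : completionTime L (0 : Fin 3) = b + 3 := by
      have := completionTime_eq hsch.not_again hx hxc
      rwa [hx0, hxf] at this
    simp only [hw, hct, one_mul]

/-- The optimum processes the jobs in the order of their arrivals, without interruptions. -/
lemma opt_tightInstance_le (ha1 : a ≤ 1) (hb2 : b ≤ 2) :
    opt (tightInstance a b ε ha hb hε) ≤ 3 * (1 + 2 * ε) := by
  let L : List (Run 3) := [⟨0, 0, 1⟩, ⟨1, 1, 2⟩, ⟨2, 2, 3⟩]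
  have hc : ∀ x ∈ L, x.Completes := by
    simp only [L, List.forall_mem_cons, Run.Completes]
    norm_num
  have hrel : ∀ x ∈ L, (![0, a, b] : Fin 3 → ℝ) x.job ≤ x.start := by
    simp [L, ha1, hb2]
  have hord : L.Pairwise fun x y => x.finish ≤ y.start := by
    norm_num [L]
  have hnot : L.Pairwise fun x y => x.Completes → y.job ≠ x.job := by
    simp [L]
  have hall : ∀ j, Completed L j := by
    intro j
    fin_cases j
    · exact ⟨⟨0, 0, 1⟩, by simp [L], rfl, hc _ (by simp [L])⟩
    · exact ⟨⟨1, 1, 2⟩, by simp [L], rfl, hc _ (by simp [L])⟩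
    · exact ⟨⟨2, 2, 3⟩, by simp [L], rfl, hc _ (by simp [L])⟩
  have hL : IsSchedule (tightInstance a b ε ha hb hε) L :=
    ⟨hrel, fun x hx => by linarith [show x.finish = x.start + 1 from hc x hx],
      fun x hx => (hc x hx).le, hord, hnot, hall⟩
  have hct : ∀ x ∈ L, completionTime L x.job = x.finish :=
    fun x hx => completionTime_eq hnot hx (hc x hx)
  simp only [L, List.forall_mem_cons] at hct
  obtain ⟨h0, h1, h2, -⟩ := hct
  refine (opt_le hL).trans ?_
  have : Nonempty (Fin (tightInstance a b ε ha hb hε).n) := ⟨(0 : Fin 3)⟩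
  refine ciSup_le fun j => ?_
  change Fin 3 at j
  fin_cases j
  · change 1 * completionTime L 0 ≤ _
    rw [h0]
    linarith
  · change (1 + ε) * completionTime L 1 ≤ _
    rw [h1]
    linarith
  · change (1 + 2 * ε) * completionTime L 2 ≤ _
    rw [h2]
    linarith

end Tight

/-- As the arrivals tend to the ends of the phases of jobs `0` and `1`, the ratio tends to
`(phaseEnd R (phaseEnd R 0) + 3) / 3`, which is `R` by the equation that defines `R`. -/
lemma exists_lt_ratio {R : ℝ} (hR0 : 3 * R ^ 3 - 2 * R ^ 2 - R - 2 = 0) (hlo : 1.3097 < R)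
    (hhi : R < 1.3098) {c : ℝ} (hc : c < R) :
    ∃ I : JobInstance, ∀ L : List (Run I.n), IsLLWSchedule R I L →
      c < weightedMakespan I L / opt I := by
  wlog hc1 : 1.3 ≤ c generalizing c
  · obtain ⟨I, hI⟩ := this (c := 1.3) (by linarith) le_rfl
    exact ⟨I, fun L hL => (not_le.1 hc1).trans (hI L hL)⟩
  obtain ⟨ε, hε, hεc⟩ : ∃ ε : ℝ, 0 < ε ∧ 10 * ε = R - c := ⟨(R - c) / 10, by linarith, by ring⟩
  have hR1 : 1 < R := by linarith
  have hp0 := mul_phaseEnd (R := R) (by linarith) 0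
  obtain ⟨a, haε⟩ : ∃ a, a = phaseEnd R 0 - ε := ⟨_, rfl⟩
  have hpa := mul_phaseEnd (R := R) (by linarith) a
  obtain ⟨b, hbε⟩ : ∃ b, b = phaseEnd R a - ε := ⟨_, rfl⟩
  have ha : 0.52 < a := by
    by_contra! h
    nlinarith
  have ha' : a < 0.53 := by
    by_contra! h
    nlinarith
  have hb : 0.9 < b := by
    by_contra! h
    nlinarith
  have hb' : b < 1 := by
    by_contra! h
    nlinarith
  have hT : a < noInterruptTime R := by
    rw [noInterruptTime, lt_div_iff₀ (by linarith)]
    nlinarith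
  have hbR : 3 * R - 2 * ε < b + 3 := by
    have h1 : R * (R * b) = 2 + R - R ^ 2 - R * ε * (1 + R) := by
      rw [hbε, haε] at *
      linear_combination R * hpa + hp0
    have h2 : R * (R * (3 * R - 2 * ε - 3)) = 2 + R - R ^ 2 - 2 * R ^ 2 * ε := by
      linear_combination hR0
    have h3 : 0 < R * (R - 1) * ε := by
      have : 0 < R - 1 := by linarith
      positivity
    by_contra! hcon
    have h4 := mul_le_mul_of_nonneg_left
      (mul_le_mul_of_nonneg_left (show b ≤ 3 * R - 2 * ε - 3 by linarith)
        (show 0 ≤ R by linarith)) (show 0 ≤ R by linarith)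
    nlinarith
  refine ⟨tightInstance a b ε (by linarith) (by linarith) hε, fun L hL => ?_⟩
  have hM := le_weightedMakespan_tightInstance hR1 (by linarith) (by linarith) (by linarith) hb'
    hT hL
  rw [lt_div_iff₀ (opt_pos _)]
  have hopt := opt_tightInstance_le (ε := ε) (ha := by linarith) (hb := by linarith) (hε := hε)
    (show a ≤ 1 by linarith) (show b ≤ 2 by linarith)
  have h5 := mul_le_mul_of_nonneg_left hopt (show 0 ≤ c by linarith)
  nlinarith

end Sched

theorem theorem2 :
    (∃! R : ℝ, 0 < R ∧ 3 * R ^ 3 - 2 * R ^ 2 - R - 2 = 0) ∧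
    ∀ R : ℝ, 0 < R → 3 * R ^ 3 - 2 * R ^ 2 - R - 2 = 0 →
      -- numerical value
      (1.3097 < R ∧ R < 1.3098) ∧
      -- every execution of the algorithm terminates, with a feasible schedule
      (∀ I : Sched.JobInstance, WellFounded fun s' s => Sched.Step R I s s') ∧
      (∀ I : Sched.JobInstance, ∃ L, Sched.IsLLWSchedule R I L) ∧
      (∀ (I : Sched.JobInstance) (L : List (Sched.Run I.n)),
        Sched.IsLLWSchedule R I L → Sched.IsSchedule I L) ∧
      -- the algorithm is `R`-competitive
      Sched.LLWCompetitive R R ∧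
      -- the bound is tight: the competitive ratio is exactly `R`, however ties are resolved
      IsLUB (Sched.llwRatios R) R ∧
      (∀ c < R, ∃ I : Sched.JobInstance, ∀ L : List (Sched.Run I.n),
        Sched.IsLLWSchedule R I L → c < Sched.weightedMakespan I L / Sched.opt I) := by
  refine ⟨Sched.existsUnique_root, fun R hpos hR => ?_⟩
  obtain ⟨hlo, hhi⟩ := Sched.root_bounds hpos hR
  have hcomp := Sched.llwCompetitive hR hlo hhi
  refine ⟨⟨hlo, hhi⟩, Sched.wellFounded_step R, Sched.exists_isLLWSchedule R,
    fun I L hL => hL.isSchedule (by linarith), hcomp, ⟨?_, ?_⟩,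
    fun c hc => Sched.exists_lt_ratio hR hlo hhi hc⟩
  · rintro _ ⟨I, L, hL, rfl⟩
    rw [div_le_iff₀ (Sched.opt_pos I)]
    exact hcomp I L hL
  · intro c hc
    by_contra! hlt
    obtain ⟨I, hI⟩ := Sched.exists_lt_ratio hR hlo hhi hlt
    obtain ⟨L, hL⟩ := Sched.exists_isLLWSchedule R I
    exact absurd (hc ⟨I, L, hL, rfl⟩) (not_le.2 (hI L hL))
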